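/- **Proposition.** Let $E\to N$ be a smooth real vector bundle of rank $n=p+q$, $p\le q$, over a compact smooth manifold $N$, endowed with a conformal class $[g]$ of smooth pseudo-Riemannian metrics of signature $(p,q)$ on the fibers ($p$ negative and $q$ positive squares). Let $A=\mathbf R^k$, with Lie algebra $\mathfrak a\cong\mathbf R^k$, act smoothly on $N$, and let this action lift to a smooth action on $E$ by bundle automorphisms that are conformal: $(e^X)^*g=\lambda(e^X,\cdot)\,g$ for all $X\in\mathfrak a$, with $\lambda(e^X,\cdot)$ smooth and positive. Let $\mu$ be an $A$-invariant, $A$-ergodic probability measure on $N$. Let $\chi_1,\dots,\chi_r\in\mathfrak a^*$ be the Lyapunov functionals of $\mu$ and $E_1,\dots,E_r$ its Oseledec spaces: the $\chi_i$ are pairwise distinct linear forms and, over a measurable set $\Lambda\subset N$ of full measure, $E=E_1\oplus\cdots\oplus E_r$ is a measurable $A$-invariant splitting into non-zero subspaces such that, for a Riemannian norm $\|\cdot\|$ on $E$ and all $x\in\Lambda$ and $v\in E_i(x)\setminus\{0\}$, $$\frac1{|X|}\bigl(\log\|e^X v\|-\chi_i(X)\bigr)\longrightarrow 0\qquad(|X|\to\infty,\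 X\in\mathfrak a).$$ Let $\chi\in\mathfrak a^*$ be the Lyapunov functional of the distortion cocycle: for $\mu$-almost every $x$, $\frac1{|X|}(\log\lambda(e^X,x)-\chi(X))\to0$ as $|X|\to\infty$ in $\mathfrak a$. Then $r\le 2p+1$. Moreover, the indices can be reordered such that, $\mu$-almost everywhere: 1. if $i+j\ne r+1$, then $E_i\perp E_j$; 2. if $i\le r/2$, then $E_i\oplus E_{r+1-i}$ is non-degenerate, $E_i$ and $E_{r+1-i}$ are maximal totally isotropic subspaces of it, and $\dim E_i=\dim E_{r+1-i}$; 3. if $r$ is even, then $p=q$ and all the $E_i$ are totally isotropic; 4. if $r$ is odd, then $E_{(r+1)/2}$ is non-degenerate; and, with the same ordering, $\chi_i+\chi_{r+1-i}=\chi$ for all $1\le i\le r$ (in particular $2\chi_{(r+1)/2}=\chi$ when $r$ is odd). -/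

import Mathlib

open Bundle Filter Topology MeasureTheory
open scoped Manifold ContDiff

noncomputable section

section VectorBundles

variable {EN : Type*} [NormedAddCommGroup EN] [NormedSpace ℝ EN]
  {H : Type*} [TopologicalSpace H] (I : ModelWithCorners ℝ EN H)
  {N : Type*} [TopologicalSpace N] [ChartedSpace H N]
  (F : Type*) [NormedAddCommGroup F] [NormedSpace ℝ F]
  (E : N → Type*) [TopologicalSpace (TotalSpace F E)]
  [∀ x, TopologicalSpace (E x)] [∀ x, AddCommGroup (E x)] [∀ x, Module ℝ (E x)]
  [∀ x, IsTopologicalAddGroup (E x)] [∀ x, ContinuousConstSMul ℝ (E x)]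
  [FiberBundle F E] [VectorBundle ℝ F E]

/-- A smooth pseudo-Riemannian metric of signature `(p, q)` on the vector bundle `E`: a smooth
family of non-degenerate symmetric bilinear forms on the fibers, whose quadratic forms have
`p` negative and `q` positive squares. -/
structure PseudoRiemannianMetric (p q : ℕ) where
  /-- The bilinear form on the fiber over `x`. -/
  form (x : N) : E x →L[ℝ] E x →L[ℝ] ℝ
  symm (x : N) (u v : E x) : form x u v = form x v u
  nondegenerate (x : N) : (form x).toBilinForm.Nondegenerate
  sigNeg_eq (x : N) : sigNeg (form x).toBilinForm.toQuadraticMap = p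
  sigPos_eq (x : N) : sigPos (form x).toBilinForm.toQuadraticMap = q
  contMDiff : ContMDiff I (I.prod 𝓘(ℝ, F →L[ℝ] F →L[ℝ] ℝ)) ∞
    (fun x ↦ TotalSpace.mk' (F →L[ℝ] F →L[ℝ] ℝ) x (form x))

/-- A smooth action of the additive group `A` (a real vector space, identified with its Lie
algebra, so that `X : A` is also written `e^X`) on the manifold `N`, together with a lift to a
smooth action on `E` by bundle automorphisms. `lift X x` is the linear map
`e^X : E(x) → E(e^X x)`; the group laws are stated in the total space. -/
structure BundleAction (A : Type*) [NormedAddCommGroup A] [NormedSpace ℝ A] [AddAction A N] where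
  contMDiff_base : ContMDiff (𝓘(ℝ, A).prod I) I ∞ (fun z : A × N ↦ z.1 +ᵥ z.2)
  /-- The linear action on the fibers. -/
  lift (X : A) (x : N) : E x →ₗ[ℝ] E (X +ᵥ x)
  lift_zero (x : N) (v : E x) :
    (⟨(0 : A) +ᵥ x, lift 0 x v⟩ : TotalSpace F E) = ⟨x, v⟩
  lift_add (X Y : A) (x : N) (v : E x) :
    (⟨(X + Y) +ᵥ x, lift (X + Y) x v⟩ : TotalSpace F E) =
      ⟨X +ᵥ (Y +ᵥ x), lift X (Y +ᵥ x) (lift Y x v)⟩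
  contMDiff_lift : ContMDiff (𝓘(ℝ, A).prod (I.prod 𝓘(ℝ, F))) (I.prod 𝓘(ℝ, F)) ∞
    (fun z : A × TotalSpace F E ↦
      (⟨z.1 +ᵥ z.2.proj, lift z.1 z.2.proj z.2.snd⟩ : TotalSpace F E))

variable {I F E} {p q : ℕ}
  {A : Type*} [NormedAddCommGroup A] [NormedSpace ℝ A] [AddAction A N]

/-- The action is conformal with respect to `g`, with conformal distortion `lam`: for every `X`,
the function `lam X` is smooth and positive, and `(e^X)^* g = lam X • g`. -/
structure IsConformalDistortion (T : BundleAction I F E A)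
    (g : PseudoRiemannianMetric I F E p q) (lam : A → N → ℝ) : Prop where
  pos (X : A) (x : N) : 0 < lam X x
  contMDiff (X : A) : ContMDiff I 𝓘(ℝ, ℝ) ∞ (lam X)
  pullback_eq (X : A) (x : N) (u v : E x) :
    g.form (X +ᵥ x) (T.lift X x u) (T.lift X x v) = lam X x * g.form x u v

/-- `χ` is the Lyapunov functional, with respect to `μ`, of the positive function `lam` on
`A × N` (the distortion cocycle). -/
def IsDistortionFunctional [MeasurableSpace N] (μ : Measure N) (lam : A → N → ℝ)
    (χ : Module.Dual ℝ A) : Prop :=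
  ∀ᵐ x ∂μ, Tendsto (fun X : A ↦ (Real.log (lam X x) - χ X) / ‖X‖)
    (Bornology.cobounded A) (𝓝 0)

/-- The norm of a vector for a (continuous) Riemannian metric on `E`. -/
def riemNorm (h : ContinuousRiemannianMetric F E) (x : N) (v : E x) : ℝ :=
  Real.sqrt (h.inner x v v)

/-- `χ 0, …, χ (r - 1)` are the Lyapunov functionals of `μ` and `V 0, …, V (r - 1)` the
corresponding Oseledec spaces, over a set of full measure `Λ`. The values of `V i x` at points
`x ∉ Λ` are irrelevant. Measurability of the subbundle `V i` over `Λ` is measurability of its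
graph in the total space of `E`. The functionals are pairwise distinct and the Oseledec spaces
are non-zero, so that `r` is the number of Lyapunov functionals. By compactness of the base the
choice of the Riemannian norm does not matter. The growth condition determines the functionals and,
almost everywhere, the spaces; no condition on Jacobian determinants or angles is required. -/
structure IsOseledecSplitting [MeasurableSpace N] (T : BundleAction I F E A) (μ : Measure N)
    (h : ContinuousRiemannianMetric F E) {r : ℕ} (Λ : Set N) (χ : Fin r → Module.Dual ℝ A)
    (V : Fin r → ∀ x, Submodule ℝ (E x)) : Prop where
  measurableSet : MeasurableSet Λ
  full_measure : μ Λᶜ = 0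
  injective : Function.Injective χ
  measurable_splitting (i : Fin r) : MeasurableSet[borel (TotalSpace F E)]
    {w : TotalSpace F E | w.proj ∈ Λ ∧ w.snd ∈ V i w.proj}
  invariant (i : Fin r) (X : A) (x : N) : x ∈ Λ → X +ᵥ x ∈ Λ →
    (V i x).map (T.lift X x) = V i (X +ᵥ x)
  ne_bot (i : Fin r) (x : N) : x ∈ Λ → V i x ≠ ⊥
  isInternal (x : N) : x ∈ Λ → DirectSum.IsInternal (fun i ↦ V i x)
  growth (i : Fin r) (x : N) (v : E x) : x ∈ Λ → v ∈ V i x → v ≠ 0 →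
    Tendsto (fun X : A ↦ (Real.log (riemNorm h (X +ᵥ x) (T.lift X x v)) - χ i X) / ‖X‖)
      (Bornology.cobounded A) (𝓝 0)

end VectorBundles

section BilinearForms

variable {V : Type*} [AddCommGroup V] [Module ℝ V]

/-- The subspaces `U` and `W` are orthogonal for `B`. -/
def SubspacesOrthogonal (B : LinearMap.BilinForm ℝ V) (U W : Submodule ℝ V) : Prop :=
  ∀ u ∈ U, ∀ w ∈ W, B u w = 0

/-- `U` is totally isotropic for `B`. -/
def TotallyIsotropic (B : LinearMap.BilinForm ℝ V) (U : Submodule ℝ V) : Prop :=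
  SubspacesOrthogonal B U U

/-- `U` is a maximal totally isotropic subspace of `W`. -/
def MaximallyIsotropicIn (B : LinearMap.BilinForm ℝ V) (U W : Submodule ℝ V) : Prop :=
  Maximal (fun U' ↦ U' ≤ W ∧ TotallyIsotropic B U') U

end BilinearForms

end

/-! For `u` in `E_i` and `v` in `E_j`, conformality and compactness give `λ(e^X, x) |g(u, v)| ≤ C
‖e^X u‖ ‖e^X v‖`. If `g(u, v) ≠ 0`, taking logarithms bounds the linear form `χ - χ_i - χ_j` above
by `o(|X|)`, so it vanishes (`IsConformalDistortion.add_eq_of_form_ne_zero`). Hence `E_i ⊥ E_j`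
unless `χ_i + χ_j = χ`.

Non-degeneracy at a single point gives every `i` a partner `τ i` with `χ_i + χ_{τ i} = χ`. It is
unique because the functionals are distinct, so `τ` is an involution independent of the point. What
remains is linear algebra in one fiber (`IsPairedSplitting`), where isotropic subspaces have
dimension at most `p`, together with an ordering of the functionals that turns `τ` into reversal. -/

/-! ### Isotropic subspaces and signature -/

section IsotropicSubspaces

variable {V : Type*} [AddCommGroup V] [Module ℝ V] [FiniteDimensional ℝ V]
  {B : LinearMap.BilinForm ℝ V} {U : Submodule ℝ V}

theorem sigPos_add_sigNeg_of_nondegenerate (hs : ∀ u v, B u v = B v u) (hB : B.Nondegenerate) :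
    sigPos B.toQuadraticMap + sigNeg B.toQuadraticMap = Module.finrank ℝ V := by
  have hrad : Module.finrank ℝ (QuadraticMap.radical B.toQuadraticMap) = 0 := by
    rw [Submodule.finrank_eq_zero, Submodule.eq_bot_iff]
    intro v hv
    rw [QuadraticMap.mem_radical_iff'] at hv
    refine hB.1 v fun w ↦ ?_
    have h1 := hv.1
    have h2 := hv.2 w
    simp only [LinearMap.BilinMap.toQuadraticMap_apply, map_add, LinearMap.add_apply] at h1 h2
    linarith [hs v w]
  have := QuadraticForm.sigPos_add_sigNeg_add_radical (Q := B.toQuadraticMap)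
  omega

/-- A totally isotropic subspace of a non-degenerate symmetric form has dimension at most the
number of negative squares. -/
theorem TotallyIsotropic.finrank_le_sigNeg (hU : TotallyIsotropic B U)
    (hs : ∀ u v, B u v = B v u) (hB : B.Nondegenerate) :
    Module.finrank ℝ U ≤ sigNeg B.toQuadraticMap := by
  -- A positive definite subspace of maximal dimension meets an isotropic one only in zero.
  obtain ⟨P, hP, hPpos⟩ := exists_finrank_eq_sigPos_and_posDef B.toQuadraticMap
  have hd : Disjoint U P := by
    rw [Submodule.disjoint_def]
    intro v hvU hvP
    by_contra hv
    have := hPpos ⟨v, hvP⟩ (by simpa using hv)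
    simp [hU v hvU v hvU] at this
  have h1 := Submodule.finrank_add_finrank_le_of_disjoint hd
  have h2 := sigPos_add_sigNeg_of_nondegenerate hs hB
  omega

/-- A totally isotropic subspace of a non-degenerate symmetric form has dimension at most the
number of positive squares. -/
theorem TotallyIsotropic.finrank_le_sigPos (hU : TotallyIsotropic B U)
    (hs : ∀ u v, B u v = B v u) (hB : B.Nondegenerate) :
    Module.finrank ℝ U ≤ sigPos B.toQuadraticMap := by
  have hU' : TotallyIsotropic (-B) U := fun u hu v hv ↦ by simp [hU u hu v hv]
  have := hU'.finrank_le_sigNeg (fun u v ↦ by simp [hs u v])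
    ⟨fun u hu ↦ hB.1 u fun v ↦ by simpa using hu v, fun u hu ↦ hB.2 u fun v ↦ by simpa using hu v⟩
  rwa [LinearMap.BilinMap.toQuadraticMap_neg, sigNeg_neg] at this

end IsotropicSubspaces

/-! ### Linear algebra of a paired splitting -/

section PairedSplitting

variable {V : Type*} [AddCommGroup V] [Module ℝ V]

theorem SubspacesOrthogonal.sup_left {B : LinearMap.BilinForm ℝ V}
    {U U' W : Submodule ℝ V} (h : SubspacesOrthogonal B U W) (h' : SubspacesOrthogonal B U' W) :
    SubspacesOrthogonal B (U ⊔ U') W := by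
  intro u hu w hw
  obtain ⟨a, ha, b, hb, rfl⟩ := Submodule.mem_sup.1 hu
  simp [h a ha w hw, h' b hb w hw]

theorem SubspacesOrthogonal.iSup {B : LinearMap.BilinForm ℝ V} {ι κ : Sort*}
    {U : ι → Submodule ℝ V} {W : κ → Submodule ℝ V}
    (h : ∀ i j, SubspacesOrthogonal B (U i) (W j)) :
    SubspacesOrthogonal B (⨆ i, U i) (⨆ j, W j) := by
  intro u hu w hw
  have h1 : ∀ i, ∀ u ∈ U i, ⨆ j, W j ≤ LinearMap.ker (B u) := fun i u hu ↦
    iSup_le fun j w hw ↦ h i j u hu w hw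
  have h2 : ⨆ i, U i ≤ LinearMap.ker (B.flip w) := iSup_le fun i u hu ↦ h1 i u hu hw
  exact h2 hu

/-- A splitting of a space carrying a non-degenerate symmetric bilinear form, together with an
involution `τ` of the index set such that each summand is orthogonal to all the summands but the
one its index is exchanged with. -/
structure IsPairedSplitting {ι : Type*} (B : LinearMap.BilinForm ℝ V)
    (W : ι → Submodule ℝ V) (τ : ι → ι) : Prop where
  symm (u v : V) : B u v = B v u
  nondegenerate : B.Nondegenerate
  independent : iSupIndep W
  iSup_eq_top : ⨆ i, W i = ⊤
  ne_bot (i : ι) : W i ≠ ⊥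
  involutive : Function.Involutive τ
  orthogonal (i j : ι) (hij : j ≠ τ i) : SubspacesOrthogonal B (W i) (W j)

namespace IsPairedSplitting

variable {ι : Type*} {B : LinearMap.BilinForm ℝ V} {W : ι → Submodule ℝ V} {τ : ι → ι}

theorem eq_zero_of_forall_orthogonal (hW : IsPairedSplitting B W τ) {u : V}
    (hu : ∀ i, ∀ w ∈ W i, B u w = 0) : u = 0 := by
  have h : ⨆ i, W i ≤ LinearMap.ker (B u) := iSup_le fun i w hw ↦ hu i w hw
  rw [hW.iSup_eq_top] at h
  exact hW.nondegenerate.1 u fun w ↦ h Submodule.mem_top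

theorem eq_zero_of_orthogonal (hW : IsPairedSplitting B W τ) {i : ι} {u : V} (hu : u ∈ W i)
    (h : ∀ w ∈ W (τ i), B u w = 0) : u = 0 := by
  refine hW.eq_zero_of_forall_orthogonal fun j w hw ↦ ?_
  by_cases hj : j = τ i
  · exact h w (hj ▸ hw)
  · exact hW.orthogonal i j hj u hu w hw

/-- The other summands are already orthogonal to this sum, so its radical lies in the radical of
`B`. The case `τ i = i` is allowed and yields the middle space. -/
theorem nondegenerate_restrict (hW : IsPairedSplitting B W τ) (i : ι) :
    (B.restrict (W i ⊔ W (τ i))).Nondegenerate := by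
  have key : ∀ u : V, u ∈ W i ⊔ W (τ i) → (∀ w ∈ W i ⊔ W (τ i), B u w = 0) → u = 0 := by
    intro u hu h
    refine hW.eq_zero_of_forall_orthogonal fun j w hw ↦ ?_
    by_cases hj : j = i
    · exact h w (Submodule.mem_sup_left (hj ▸ hw))
    by_cases hj' : j = τ i
    · exact h w (Submodule.mem_sup_right (hj' ▸ hw))
    · exact (hW.orthogonal i j hj').sup_left
        (hW.orthogonal (τ i) j (by rwa [hW.involutive i])) u hu w hw
  refine ⟨fun u hu ↦ ?_, fun u hu ↦ ?_⟩
  · exact Subtype.ext (key u u.2 fun w hw ↦ hu ⟨w, hw⟩)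
  · exact Subtype.ext (key u u.2 fun w hw ↦ (hW.symm u w).trans (hu ⟨w, hw⟩))

theorem totallyIsotropic (hW : IsPairedSplitting B W τ) {i : ι} (hi : τ i ≠ i) :
    TotallyIsotropic B (W i) :=
  hW.orthogonal i i hi.symm

theorem maximallyIsotropicIn (hW : IsPairedSplitting B W τ) {i : ι} (hi : τ i ≠ i) :
    MaximallyIsotropicIn B (W i) (W i ⊔ W (τ i)) := by
  refine ⟨⟨le_sup_left, hW.totallyIsotropic hi⟩, fun U ⟨hU, hUiso⟩ hle u hu ↦ ?_⟩
  obtain ⟨a, ha, b, hb, rfl⟩ := Submodule.mem_sup.1 (hU hu)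
  -- Both `a + b` and `a` are orthogonal to `W i`, hence so is `b`; but `W i` is the partner of `W
  -- (τ i)`.
  have hb0 : b = 0 := by
    refine hW.eq_zero_of_orthogonal hb fun w hw ↦ ?_
    rw [hW.involutive i] at hw
    have h1 := hUiso _ hu _ (hle hw)
    rwa [map_add, LinearMap.add_apply, hW.totallyIsotropic hi a ha w hw, zero_add] at h1
  simpa [hb0] using ha

variable [FiniteDimensional ℝ V]

/-- The form embeds `W i` into the dual of its partner. -/
theorem finrank_le (hW : IsPairedSplitting B W τ) (i : ι) :
    Module.finrank ℝ (W i) ≤ Module.finrank ℝ (W (τ i)) := by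
  rw [← Subspace.dual_finrank_eq (V := W (τ i))]
  refine LinearMap.finrank_le_finrank_of_injective
    (f := (LinearMap.lcomp ℝ ℝ (W (τ i)).subtype) ∘ₗ B ∘ₗ (W i).subtype) ?_
  rw [← LinearMap.ker_eq_bot, LinearMap.ker_eq_bot']
  intro u hu
  refine Subtype.ext (hW.eq_zero_of_orthogonal u.2 fun w hw ↦ ?_)
  exact LinearMap.congr_fun hu ⟨w, hw⟩

theorem finrank_eq (hW : IsPairedSplitting B W τ) (i : ι) :
    Module.finrank ℝ (W i) = Module.finrank ℝ (W (τ i)) :=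
  (hW.finrank_le i).antisymm <| (hW.finrank_le (τ i)).trans_eq (by rw [hW.involutive i])

/-- If the indices in `s` are pairwise not exchanged by `τ`, then the number of elements of `s` is
bounded by the number of negative squares. -/
theorem card_le_sigNeg (hW : IsPairedSplitting B W τ) (s : Finset ι)
    (hs : ∀ i ∈ s, ∀ j ∈ s, j ≠ τ i) : s.card ≤ sigNeg B.toQuadraticMap := by
  -- One non-zero vector per summand suffices for the count.
  choose v hv hv0 using fun i ↦ Submodule.exists_mem_ne_zero_of_ne_bot (hW.ne_bot i)
  have hli : LinearIndependent ℝ v := hW.independent.linearIndependent W hv hv0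
  have hli' := hli.comp ((↑) : s → ι) Subtype.coe_injective
  have hiso : TotallyIsotropic B (⨆ i : s, W i) :=
    SubspacesOrthogonal.iSup fun i j ↦ hW.orthogonal i j (hs i i.2 j j.2)
  have hle : Submodule.span ℝ (Set.range (v ∘ ((↑) : s → ι))) ≤ ⨆ i : s, W i := by
    rw [Submodule.span_le]
    rintro _ ⟨i, rfl⟩
    exact Submodule.mem_iSup_of_mem i (hv i)
  calc s.card = Module.finrank ℝ (Submodule.span ℝ (Set.range (v ∘ ((↑) : s → ι)))) := by
        rw [finrank_span_eq_card hli', Fintype.card_coe]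
    _ ≤ Module.finrank ℝ ↥(⨆ i : s, W i) := Submodule.finrank_mono hle
    _ ≤ _ := hiso.finrank_le_sigNeg hW.symm hW.nondegenerate

/-- If the index set is the union of two parts inside which no two indices are exchanged by `τ`,
then the form has signature zero. -/
theorem sigNeg_eq_sigPos (hW : IsPairedSplitting B W τ) (s : Set ι)
    (hs : ∀ i ∈ s, ∀ j ∈ s, j ≠ τ i) (hs' : ∀ i ∉ s, ∀ j ∉ s, j ≠ τ i) :
    sigNeg B.toQuadraticMap = sigPos B.toQuadraticMap := by
  have h1 : TotallyIsotropic B (⨆ i : s, W i) :=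
    SubspacesOrthogonal.iSup fun i j ↦ hW.orthogonal i j (hs i i.2 j j.2)
  have h2 : TotallyIsotropic B (⨆ i : ↥(sᶜ), W i) :=
    SubspacesOrthogonal.iSup fun i j ↦ hW.orthogonal i j (hs' i i.2 j j.2)
  -- Two isotropic subspaces, each of dimension at most both indices of inertia, fill the whole
  -- space.
  have htop : (⨆ i : s, W i) ⊔ (⨆ i : ↥(sᶜ), W i) = ⊤ := by
    rw [eq_top_iff, ← hW.iSup_eq_top]
    refine iSup_le fun i ↦ ?_
    by_cases hi : i ∈ s
    · exact le_sup_of_le_left (le_iSup_of_le (⟨i, hi⟩ : s) le_rfl)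
    · exact le_sup_of_le_right (le_iSup_of_le (⟨i, hi⟩ : ↥(sᶜ)) le_rfl)
  have h3 := Submodule.finrank_add_le_finrank_add_finrank (⨆ i : s, W i) (⨆ i : ↥(sᶜ), W i)
  rw [htop, finrank_top] at h3
  have h4 := sigPos_add_sigNeg_of_nondegenerate hW.symm hW.nondegenerate
  have h5 := h1.finrank_le_sigNeg hW.symm hW.nondegenerate
  have h6 := h1.finrank_le_sigPos hW.symm hW.nondegenerate
  have h7 := h2.finrank_le_sigNeg hW.symm hW.nondegenerate
  have h8 := h2.finrank_le_sigPos hW.symm hW.nondegenerate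
  omega

end IsPairedSplitting

end PairedSplitting

/-! ### Ordering the functionals -/

section Sorting

/-- A finite family of distinct elements of an ordered group which is symmetric with respect to
`a ↦ c - a` can be ordered so that this symmetry becomes the reversal of the order. -/
theorem exists_perm_apply_rev {G : Type*} [AddCommGroup G] [LinearOrder G] [IsOrderedAddMonoid G]
    {r : ℕ} {f : Fin r → G} (hf : Function.Injective f) {c : G} {τ : Fin r → Fin r}
    (hτ : ∀ i, f i + f (τ i) = c) :
    ∃ σ : Equiv.Perm (Fin r), ∀ i, σ i.rev = τ (σ i) := by
  have hinv : Function.Involutive τ := fun i ↦ hf <| by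
    rw [← add_right_inj (f (τ i)), hτ, add_comm, hτ]
  refine ⟨Tuple.sort f, fun i ↦ ?_⟩
  -- The sorted family and its reflection, read backwards, are increasing with the same range, hence
  -- equal.
  have hmono : StrictMono (f ∘ Tuple.sort f) :=
    (Tuple.monotone_sort f).strictMono_of_injective (hf.comp (Tuple.sort f).injective)
  have hmono' : StrictMono fun i : Fin r ↦ f (τ (Tuple.sort f i.rev)) := by
    intro i j hij
    have h1 : f (Tuple.sort f j.rev) < f (Tuple.sort f i.rev) := hmono (Fin.rev_lt_rev.2 hij)
    have h2 := (hτ (Tuple.sort f j.rev)).trans (hτ (Tuple.sort f i.rev)).symm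
    by_contra! h3
    exact (add_lt_add_of_lt_of_le h1 h3).ne h2
  have hrange : Set.range (f ∘ Tuple.sort f) =
      Set.range fun i : Fin r ↦ f (τ (Tuple.sort f i.rev)) := by
    rw [(Tuple.sort f).surjective.range_comp f, ← hinv.surjective.range_comp f,
      ← (Tuple.sort f).surjective.range_comp (f ∘ τ),
      ← Fin.rev_surjective.range_comp ((f ∘ τ) ∘ Tuple.sort f)]
    rfl
  have := congrFun ((StrictMono.range_inj hmono hmono').1 hrange) i.rev
  simpa [Fin.rev_rev] using hf this

/-- A finite family of distinct linear forms which is symmetric with respect to `ψ ↦ c - ψ` can be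
ordered so that this symmetry becomes the reversal of the order. -/
theorem exists_perm_apply_rev_of_dual {A : Type*} [AddCommGroup A] [Module ℝ A]
    [FiniteDimensional ℝ A] {r : ℕ} {χ : Fin r → Module.Dual ℝ A} (hχ : Function.Injective χ)
    {c : Module.Dual ℝ A} {τ : Fin r → Fin r} (hτ : ∀ i, χ i + χ (τ i) = c) :
    ∃ σ : Equiv.Perm (Fin r), ∀ i, σ i.rev = τ (σ i) := by
  -- Lexicographic order on coordinates makes the dual a linearly ordered group.
  let e := (Module.finBasis ℝ (Module.Dual ℝ A)).equivFun
  refine exists_perm_apply_rev (f := fun i ↦ toLex (e (χ i))) (c := toLex (e c))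
    (toLex.injective.comp (e.injective.comp hχ)) fun i ↦ ?_
  rw [← hτ i, map_add]
  rfl

end Sorting

/-! ### Linear forms of sublinear growth -/

section Growth

/-- A linear form bounded above by a function that is negligible with respect to the norm
vanishes. -/
theorem LinearMap.eq_zero_of_div_norm_le {A : Type*} [NormedAddCommGroup A] [NormedSpace ℝ A]
    {ψ : Module.Dual ℝ A} {ε : A → ℝ} (hε : Tendsto ε (Bornology.cobounded A) (𝓝 0))
    (h : ∀ X, ψ X / ‖X‖ ≤ ε X) : ψ = 0 := by
  have key : ∀ X, ψ X ≤ 0 := by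
    intro X
    rcases eq_or_ne X 0 with rfl | hX
    · simp
    have hX' : 0 < ‖X‖ := norm_pos_iff.2 hX
    -- Along the ray `t • X` the quotient `ψ X / ‖X‖` is constant, so the limit bounds it by zero.
    have hlim : Tendsto (fun t : ℝ ↦ t • X) atTop (Bornology.cobounded A) := by
      rw [← tendsto_norm_atTop_iff_cobounded]
      simp only [norm_smul]
      exact (tendsto_norm_atTop_atTop).atTop_mul_const hX'
    have hle : ψ X / ‖X‖ ≤ 0 := by
      refine ge_of_tendsto (hε.comp hlim) ?_
      filter_upwards [eventually_gt_atTop 0] with t ht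
      have := h (t • X)
      rwa [map_smul, norm_smul, smul_eq_mul, Real.norm_of_nonneg ht.le,
        mul_div_mul_left _ _ ht.ne'] at this
    simpa using (div_le_iff₀ hX').1 hle
  ext X
  have h1 := key X
  have h2 := key (-X)
  rw [map_neg] at h2
  simpa using le_antisymm h1 (by linarith)

end Growth

/-! ### Uniform bounds and the growth of the distortion -/

section Bundles

theorem ContinuousAt.eventually_norm_lt_norm_add_one {N G : Type*} [TopologicalSpace N]
    [SeminormedAddCommGroup G] {f : N → G} {x : N} (hf : ContinuousAt f x) :
    ∀ᶠ y in 𝓝 x, ‖f y‖ < ‖f x‖ + 1 :=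
  hf.norm.eventually_lt_const (lt_add_one _)

/-- On a compact base, a continuous family of bilinear forms on the fibers of a Riemannian bundle
is uniformly bounded. -/
theorem exists_forall_abs_le_mul_norm_mul_norm {N : Type*} [TopologicalSpace N] [CompactSpace N]
    {F : Type*} [NormedAddCommGroup F] [NormedSpace ℝ F]
    {E : N → Type*} [TopologicalSpace (TotalSpace F E)] [∀ x, NormedAddCommGroup (E x)]
    [∀ x, InnerProductSpace ℝ (E x)] [FiberBundle F E] [VectorBundle ℝ F E]
    [IsContinuousRiemannianBundle F E] (b : ∀ x, E x →L[ℝ] E x →L[ℝ] ℝ)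
    (hb : Continuous fun x ↦ TotalSpace.mk' (F →L[ℝ] F →L[ℝ] ℝ) x (b x)) :
    ∃ C > 0, ∀ x (u v : E x), |b x u v| ≤ C * ‖u‖ * ‖v‖ := by
  have hloc : ∀ x : N, ∃ C > 0, ∀ᶠ y in 𝓝 x, ∀ u v : E y, |b y u v| ≤ C * ‖u‖ * ‖v‖ := by
    intro x
    have hx : x ∈ (trivializationAt F E x).baseSet := FiberBundle.mem_baseSet_trivializationAt' x
    -- The form read in a fixed trivialization near `x`, where its operator norm is locally bounded.
    let b' : N → F →L[ℝ] F →L[ℝ] ℝ := fun y ↦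
      ContinuousLinearMap.inCoordinates F E (F →L[ℝ] ℝ) (fun x ↦ E x →L[ℝ] ℝ) x y x y (b y)
    have hb' : ContinuousAt b' x := by
      have W := hb.continuousAt (x := x)
      simp only [continuousAt_hom_bundle] at W
      exact W.2
    obtain ⟨C, hC, hCx⟩ := eventually_norm_trivializationAt_lt F E x
    have hbound : ∀ᶠ y in 𝓝 x, ‖b' y‖ < ‖b' x‖ + 1 :=
      ContinuousAt.eventually_norm_lt_norm_add_one (G := F →L[ℝ] F →L[ℝ] ℝ) hb'
    refine ⟨(‖b' x‖ + 1) * C * C, by positivity, ?_⟩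
    filter_upwards [hCx, hbound, (trivializationAt F E x).open_baseSet.mem_nhds hx]
      with y hy hby hyx u v
    let e := (trivializationAt F E x).continuousLinearMapAt ℝ y
    have hsymm : ∀ u : E y, (trivializationAt F E x).symm y
        ((trivializationAt F E x).linearMapAt ℝ y u) = u := fun u ↦ by
      convert! ((trivializationAt F E x).continuousLinearEquivAt ℝ _ hyx).symm_apply_apply u
      simp [Trivialization.coe_continuousLinearEquivAt_eq _ hyx]
    have heq : b y u v = b' y (e u) (e v) := by
      rw [inCoordinates_apply_eq₂ hyx hyx (Set.mem_univ _)]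
      simp [hsymm, e]
    have he : ∀ u, ‖e u‖ ≤ C * ‖u‖ := fun u ↦ e.le_of_opNorm_le hy.le u
    calc |b y u v| = ‖b' y (e u) (e v)‖ := by rw [heq, Real.norm_eq_abs]
      _ ≤ ‖b' y‖ * ‖e u‖ * ‖e v‖ := (b' y).le_opNorm₂ _ _
      _ ≤ (‖b' x‖ + 1) * (C * ‖u‖) * (C * ‖v‖) := by gcongr <;> exact he _
      _ = (‖b' x‖ + 1) * C * C * ‖u‖ * ‖v‖ := by ring
  choose C hC hCx using hloc
  obtain ⟨t, -, ht⟩ := isCompact_univ.elim_nhds_subcover _ fun x _ ↦ hCx x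
  -- The summand `1` keeps the constant positive when `t` is empty.
  refine ⟨1 + ∑ x ∈ t, C x, add_pos_of_pos_of_nonneg one_pos
    (Finset.sum_nonneg fun x _ ↦ (hC x).le), fun y u v ↦ ?_⟩
  obtain ⟨x, hxt, hx⟩ := Set.mem_iUnion₂.1 (ht (Set.mem_univ y))
  refine (hx u v).trans ?_
  have : C x ≤ 1 + ∑ x ∈ t, C x := by
    linarith [Finset.single_le_sum (f := C) (fun x _ ↦ (hC x).le) hxt]
  gcongr

variable {EN : Type*} [NormedAddCommGroup EN] [NormedSpace ℝ EN]
  {H : Type*} [TopologicalSpace H] {I : ModelWithCorners ℝ EN H}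
  {N : Type*} [TopologicalSpace N] [ChartedSpace H N]
  {F : Type*} [NormedAddCommGroup F] [NormedSpace ℝ F]
  {E : N → Type*} [TopologicalSpace (TotalSpace F E)]
  [∀ x, TopologicalSpace (E x)] [∀ x, AddCommGroup (E x)] [∀ x, Module ℝ (E x)]
  [∀ x, IsTopologicalAddGroup (E x)] [∀ x, ContinuousConstSMul ℝ (E x)]
  [FiberBundle F E] [VectorBundle ℝ F E] {p q : ℕ}

theorem PseudoRiemannianMetric.exists_forall_abs_form_le [CompactSpace N]
    (g : PseudoRiemannianMetric I F E p q) (h : ContinuousRiemannianMetric F E) :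
    ∃ C > 0, ∀ x (u v : E x), |g.form x u v| ≤ C * riemNorm h x u * riemNorm h x v := by
  let _ : RiemannianBundle E := ⟨h.toRiemannianMetric⟩
  obtain ⟨C, hC, hCx⟩ :=
    exists_forall_abs_le_mul_norm_mul_norm (F := F) (E := E) g.form g.contMDiff.continuous
  refine ⟨C, hC, fun x u v ↦ ?_⟩
  have hnorm : ∀ u : E x, ‖u‖ = riemNorm h x u := fun u ↦ norm_eq_sqrt_real_inner u
  rw [← hnorm, ← hnorm]
  exact hCx x u v

variable {A : Type*} [NormedAddCommGroup A] [NormedSpace ℝ A] [AddAction A N]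

/-- If two vectors growing at rates `χ₁` and `χ₂` are not orthogonal, then the distortion grows at
rate `χ₁ + χ₂`. -/
theorem IsConformalDistortion.add_eq_of_form_ne_zero [CompactSpace N] {T : BundleAction I F E A}
    {g : PseudoRiemannianMetric I F E p q} {lam : A → N → ℝ} (hlam : IsConformalDistortion T g lam)
    (h : ContinuousRiemannianMetric F E) {x : N} {u v : E x} {χ₀ χ₁ χ₂ : Module.Dual ℝ A}
    (h₀ : Tendsto (fun X : A ↦ (Real.log (lam X x) - χ₀ X) / ‖X‖) (Bornology.cobounded A) (𝓝 0))
    (h₁ : Tendsto (fun X : A ↦ (Real.log (riemNorm h (X +ᵥ x) (T.lift X x u)) - χ₁ X) / ‖X‖)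
      (Bornology.cobounded A) (𝓝 0))
    (h₂ : Tendsto (fun X : A ↦ (Real.log (riemNorm h (X +ᵥ x) (T.lift X x v)) - χ₂ X) / ‖X‖)
      (Bornology.cobounded A) (𝓝 0))
    (huv : g.form x u v ≠ 0) : χ₁ + χ₂ = χ₀ := by
  obtain ⟨C, hC, hCx⟩ := g.exists_forall_abs_form_le h
  set K : ℝ := Real.log C - Real.log |g.form x u v|
  have hK : Tendsto (fun X : A ↦ K / ‖X‖) (Bornology.cobounded A) (𝓝 0) :=
    tendsto_const_nhds.div_atTop tendsto_norm_cobounded_atTop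
  have hlim := ((hK.add h₁).add h₂).sub h₀
  simp only [add_zero, sub_zero] at hlim
  have hψ : χ₀ - χ₁ - χ₂ = 0 := by
    refine LinearMap.eq_zero_of_div_norm_le hlim fun X ↦ ?_
    rw [← add_div, ← add_div, ← sub_div]
    refine div_le_div_of_nonneg_right ?_ (norm_nonneg X)
    have hpos : 0 < lam X x * |g.form x u v| := mul_pos (hlam.pos X x) (abs_pos.2 huv)
    have hle := hCx (X +ᵥ x) (T.lift X x u) (T.lift X x v)
    rw [hlam.pullback_eq, abs_mul, abs_of_pos (hlam.pos X x)] at hle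
    set a := riemNorm h (X +ᵥ x) (T.lift X x u)
    set b := riemNorm h (X +ᵥ x) (T.lift X x v)
    -- The positive lower bound forces both norms to be non-zero, so the logarithm of the product
    -- splits.
    have hne : C * a * b ≠ 0 := (hpos.trans_le hle).ne'
    have ha : a ≠ 0 := fun ha ↦ hne (by simp [ha])
    have hb : b ≠ 0 := fun hb ↦ hne (by simp [hb])
    have hlog := Real.log_le_log hpos hle
    rw [Real.log_mul (hlam.pos X x).ne' (abs_pos.2 huv).ne', Real.log_mul (by positivity) hb,
      Real.log_mul hC.ne' ha] at hlog
    simp only [LinearMap.sub_apply, K]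
    linarith
  rw [sub_sub, sub_eq_zero] at hψ
  exact hψ.symm

end Bundles

/-! ### Proof of the proposition -/

theorem mainTheorem4
    {EN : Type*} [NormedAddCommGroup EN] [NormedSpace ℝ EN] [FiniteDimensional ℝ EN]
    {H : Type*} [TopologicalSpace H] (I : ModelWithCorners ℝ EN H)
    {N : Type*} [TopologicalSpace N] [ChartedSpace H N] [IsManifold I ∞ N]
    [CompactSpace N] [T2Space N] [MeasurableSpace N] [BorelSpace N]
    {F : Type*} [NormedAddCommGroup F] [NormedSpace ℝ F] [FiniteDimensional ℝ F]
    {E : N → Type*} [TopologicalSpace (TotalSpace F E)]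
    [∀ x, TopologicalSpace (E x)] [∀ x, AddCommGroup (E x)] [∀ x, Module ℝ (E x)]
    [∀ x, IsTopologicalAddGroup (E x)] [∀ x, ContinuousConstSMul ℝ (E x)]
    [FiberBundle F E] [VectorBundle ℝ F E] [ContMDiffVectorBundle ∞ F E I]
    -- a metric `g` in the conformal class, of signature `(p, q)`
    {p q : ℕ} (hpq : p ≤ q) (g : PseudoRiemannianMetric I F E p q)
    -- a conformal action of `ℝ^k`, with conformal distortion `lam`
    {k : ℕ} [AddAction (EuclideanSpace ℝ (Fin k)) N]
    (T : BundleAction I F E (EuclideanSpace ℝ (Fin k)))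
    (lam : EuclideanSpace ℝ (Fin k) → N → ℝ) (hlam : IsConformalDistortion T g lam)
    -- an invariant ergodic probability measure
    (μ : Measure N) [IsProbabilityMeasure μ] [ErgodicVAdd (EuclideanSpace ℝ (Fin k)) N μ]
    -- its Lyapunov functionals and Oseledec spaces (with respect to some Riemannian norm)
    (h : ContinuousRiemannianMetric F E) {r : ℕ} (Λ : Set N)
    (χ : Fin r → Module.Dual ℝ (EuclideanSpace ℝ (Fin k)))
    (V : Fin r → ∀ x, Submodule ℝ (E x)) (hV : IsOseledecSplitting T μ h Λ χ V)
    -- the Lyapunov functional of the distortion cocycle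
    (χ₀ : Module.Dual ℝ (EuclideanSpace ℝ (Fin k)))
    (hχ₀ : IsDistortionFunctional μ lam χ₀) :
    r ≤ 2 * p + 1 ∧
    (Even r → p = q) ∧
    -- with the functionals reordered by `σ`; the indices are `0, …, r - 1`, and
    -- `i.rev` is `r - 1 - i`
    ∃ σ : Equiv.Perm (Fin r),
      (∀ᵐ x ∂μ,
        (∀ i j : Fin r, j ≠ i.rev →
          SubspacesOrthogonal (g.form x).toBilinForm (V (σ i) x) (V (σ j) x)) ∧
        (∀ i : Fin r, 2 * ((i : ℕ) + 1) ≤ r →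
          ((g.form x).toBilinForm.restrict (V (σ i) x ⊔ V (σ i.rev) x)).Nondegenerate ∧
          MaximallyIsotropicIn (g.form x).toBilinForm (V (σ i) x)
            (V (σ i) x ⊔ V (σ i.rev) x) ∧
          MaximallyIsotropicIn (g.form x).toBilinForm (V (σ i.rev) x)
            (V (σ i) x ⊔ V (σ i.rev) x) ∧
          Module.finrank ℝ (V (σ i) x) = Module.finrank ℝ (V (σ i.rev) x)) ∧
        (Even r → ∀ i : Fin r, TotallyIsotropic (g.form x).toBilinForm (V i x)) ∧
        (∀ i : Fin r, 2 * (i : ℕ) + 1 = r →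
          ((g.form x).toBilinForm.restrict (V (σ i) x)).Nondegenerate)) ∧
      (∀ i : Fin r, χ (σ i) + χ (σ i.rev) = χ₀) := by
  have hfin : ∀ x, FiniteDimensional ℝ (E x) := fun x ↦
    ((trivializationAt F E x).continuousLinearEquivAt ℝ x
      (FiberBundle.mem_baseSet_trivializationAt' x)).symm.toLinearEquiv.finiteDimensional
  have hgood : ∀ᵐ x ∂μ, x ∈ Λ ∧ Tendsto (fun X ↦ (Real.log (lam X x) - χ₀ X) / ‖X‖)
      (Bornology.cobounded (EuclideanSpace ℝ (Fin k))) (𝓝 0) :=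
    (show ∀ᵐ x ∂μ, x ∈ Λ from hV.full_measure).and hχ₀
  have hsum : ∀ x ∈ Λ, Tendsto (fun X ↦ (Real.log (lam X x) - χ₀ X) / ‖X‖)
      (Bornology.cobounded (EuclideanSpace ℝ (Fin k))) (𝓝 0) → ∀ i j, χ i + χ j ≠ χ₀ →
      SubspacesOrthogonal (g.form x).toBilinForm (V i x) (V j x) := by
    intro x hx hlim i j hij u hu v hv
    by_contra huv
    have hu0 : u ≠ 0 := by rintro rfl; simp at huv
    have hv0 : v ≠ 0 := by rintro rfl; simp at huv
    exact hij (hlam.add_eq_of_form_ne_zero h hlim (hV.growth i x u hx hu hu0)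
      (hV.growth j x v hx hv hv0) huv)
  -- One good point suffices: the relation `χ i + χ j = χ₀` does not involve the point.
  obtain ⟨x₀, hx₀, hlim₀⟩ := hgood.exists
  have hpair : ∀ i, ∃ j, χ i + χ j = χ₀ := by
    intro i
    -- Without a partner, `V i x₀` would be orthogonal to every summand.
    by_contra! hi
    obtain ⟨u, hu, hu0⟩ := Submodule.exists_mem_ne_zero_of_ne_bot (hV.ne_bot i x₀ hx₀)
    refine hu0 ((g.nondegenerate x₀).1 u fun w ↦ ?_)
    have hle : ⨆ j, V j x₀ ≤ LinearMap.ker ((g.form x₀).toBilinForm u) :=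
      iSup_le fun j w hw ↦ hsum x₀ hx₀ hlim₀ i j (hi j) u hu w hw
    rw [(hV.isInternal x₀ hx₀).submodule_iSup_eq_top] at hle
    exact hle Submodule.mem_top
  choose τ hτ using hpair
  have hinv : Function.Involutive τ := fun i ↦ hV.injective <| by
    rw [← add_right_inj (χ (τ i)), hτ, add_comm, hτ]
  have hsplit : ∀ x ∈ Λ, Tendsto (fun X ↦ (Real.log (lam X x) - χ₀ X) / ‖X‖)
      (Bornology.cobounded (EuclideanSpace ℝ (Fin k))) (𝓝 0) →
      IsPairedSplitting (g.form x).toBilinForm (fun i ↦ V i x) τ := fun x hx hlim ↦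
    { symm := g.symm x
      nondegenerate := g.nondegenerate x
      independent := (hV.isInternal x hx).submodule_iSupIndep
      iSup_eq_top := (hV.isInternal x hx).submodule_iSup_eq_top
      ne_bot := fun i ↦ hV.ne_bot i x hx
      involutive := hinv
      orthogonal := fun i j hij ↦ hsum x hx hlim i j fun hχ ↦
        hij (hV.injective (add_left_cancel (hχ.trans (hτ i).symm))) }
  obtain ⟨σ, hσ⟩ := exists_perm_apply_rev_of_dual hV.injective hτ
  have hτσ : ∀ i j, σ j = τ (σ i) ↔ (i : ℕ) + j + 1 = r := fun i j ↦ by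
    rw [← hσ, σ.injective.eq_iff, Fin.ext_iff, Fin.val_rev]
    omega
  have hW₀ := hsplit x₀ hx₀ hlim₀
  refine ⟨?_, fun hr ↦ ?_, σ, ?_, fun i ↦ by rw [hσ, hτ]⟩
  -- Two indices of the first half satisfy `i + j + 2 ≤ r`, so they are never partners; this half
  -- has at least `r / 2` elements.
  · have hcard := hW₀.card_le_sigNeg
      ((Finset.univ.filter fun i : Fin r ↦ 2 * ((i : ℕ) + 1) ≤ r).map σ.toEmbedding) (by
        simp only [Finset.mem_map, Finset.mem_filter, Finset.mem_univ, true_and]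
        rintro _ ⟨i, hi, rfl⟩ _ ⟨j, hj, rfl⟩
        simp only [Equiv.coe_toEmbedding, ne_eq, hτσ]
        omega)
    rw [g.sigNeg_eq x₀, Finset.card_map] at hcard
    have hle : r / 2 ≤ (Finset.univ.filter fun i : Fin r ↦ 2 * ((i : ℕ) + 1) ≤ r).card := by
      rw [← Fintype.card_fin (r / 2), ← Finset.card_univ,
        ← Finset.card_map (Fin.castLEEmb (Nat.div_le_self r 2))]
      refine Finset.card_le_card fun i hi ↦ ?_
      simp only [Finset.mem_map, Finset.mem_filter, Finset.mem_univ, true_and] at hi ⊢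
      obtain ⟨j, rfl⟩ := hi
      have := j.2
      simp only [Fin.castLEEmb_apply, Fin.val_castLE]
      omega
    omega
  -- For even `r` the second half contains no partners either: there `i + j ≥ r`.
  · have hsig := hW₀.sigNeg_eq_sigPos (σ '' {i | 2 * ((i : ℕ) + 1) ≤ r})
      (by
        rintro _ ⟨i, hi, rfl⟩ _ ⟨j, hj, rfl⟩
        simp only [Set.mem_ofPred_eq] at hi hj
        rw [ne_eq, hτσ]
        omega)
      (by
        intro i hi j hj
        obtain ⟨i, rfl⟩ := σ.surjective i
        obtain ⟨j, rfl⟩ := σ.surjective j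
        simp only [σ.injective.mem_set_image, Set.mem_ofPred_eq] at hi hj
        rw [ne_eq, hτσ]
        obtain ⟨m, rfl⟩ := hr
        omega)
    rwa [g.sigNeg_eq, g.sigPos_eq] at hsig
  · filter_upwards [hgood] with x ⟨hx, hlim⟩
    have hW := hsplit x hx hlim
    refine ⟨fun i j hij ↦ ?_, fun i hi ↦ ?_, fun hr i ↦ ?_, fun i hi ↦ ?_⟩
    · exact hW.orthogonal _ _ (by rwa [← hσ, σ.injective.ne_iff])
    · have hne : τ (σ i) ≠ σ i := by
        rw [ne_comm, ne_eq, hτσ]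
        omega
      rw [hσ]
      refine ⟨hW.nondegenerate_restrict _, hW.maximallyIsotropicIn hne, ?_, hW.finrank_eq _⟩
      have := hW.maximallyIsotropicIn (i := τ (σ i)) (by rw [hinv]; exact hne.symm)
      rwa [hinv, sup_comm] at this
    · obtain ⟨i, rfl⟩ := σ.surjective i
      refine hW.totallyIsotropic ?_
      rw [ne_comm, ne_eq, hτσ]
      obtain ⟨m, rfl⟩ := hr
      omega
    -- The middle index is its own partner.
    · have heq : τ (σ i) = σ i := by
        rw [eq_comm, hτσ]
        omega
      have := hW.nondegenerate_restrict (σ i)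
      rwa [heq, sup_idem] at this
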